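/- Let $G$ be a group generated by a finite symmetric set $A=A^{-1}$, and for $r\ge 0$ let $B_r\subseteq G$ be the ball consisting of all products of at most $r$ elements of $A$. A sequence $(F_n)$ of finite subsets of $G$ is called Besicovitch if there is a constant $C$ such that for every finite $D\subseteq G$ and every family $(F_{n(g)}g)_{g\in D}$ there is $D'\subseteq D$ such that $1_D\le\sum_{g\in D'}1_{F_{n(g)}g}\le C$; it is called strongly non-Besicovitch if for every finite $E\subseteq G$ there is a finite $\widetilde E\subseteq G$ with $E\cup\{1_G\}\subseteq\widetilde E$ such that $(\widetilde E F_n)$ is not Besicovitch. Let $F_n=B_{k(n)}$, $n\in\mathbb N$, be a sequence of balls which is strongly non-Besicovitch. Then there exist a $\sigma$-finite non-atomic measure space $(X,\mathcal B,\mu)$, an ergodic measure-preserving action $(T^g)_{g\in G}$ of $G$ on it, and functions $\varphi,\psi\in L^1(\mu)\cap L^\infty(\mu)$ with $\int\psi\,d\mu\neq 0$, such that for $\mu$-a.e. $x$ the ratios $$R_{F_n}(\varphi,\psi)(x)=\frac{\sum_{g\in F_n}\varphi(T^gx)}{\sum_{g\in F_n}\psi(T^gx)}$$ have nonzero denominator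 for all sufficiently large $n$ and do not converge to a real number as $n\to\infty$. -/

import Mathlib

open MeasureTheory Filter Topology
open scoped Pointwise

section Groups

variable {G : Type*} [Group G] [DecidableEq G]

/-- The ball of radius `r` with respect to `A`: all products of at most `r` elements of `A`. -/
def wordBall (A : Finset G) (r : ℕ) : Finset G := (insert 1 A) ^ r

/-- The (right) Besicovitch covering property of a sequence of finite subsets of a group: there is
a constant `C` such that every family `(F (n g) * g)`, `g ∈ A`, of right translates, with `A`
finite, has a subfamily indexed by some `A' ⊆ A` that covers `A` and has multiplicity at most
`C`. -/
def IsBesicovitch (F : ℕ → Finset G) : Prop :=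
  ∃ C : ℕ, ∀ (A : Finset G) (n : G → ℕ), ∃ A' ⊆ A,
    (∀ a ∈ A, ∃ g ∈ A', a ∈ F (n g) * {g}) ∧
    ∀ x : G, (A'.filter fun g => x ∈ F (n g) * {g}).card ≤ C

/-- Every finite set `E` is contained in a finite set `E'` with `1 ∈ E'` such that the sequence
`E' * F n` does not have the Besicovitch covering property. -/
def IsStronglyNonBesicovitch (F : ℕ → Finset G) : Prop :=
  ∀ E : Finset G, ∃ E' : Finset G, E ⊆ E' ∧ 1 ∈ E' ∧ ¬ IsBesicovitch fun n => E' * F n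

end Groups

/-- The sum of `φ` over the translates of `x` by the elements of the finite set `F`. -/
def ergodicSum {G X : Type*} [SMul G X] (F : Finset G) (φ : X → ℝ) (x : X) : ℝ :=
  ∑ g ∈ F, φ (g • x)

/-- The ratio of the sums of `φ` and of `ψ` over `F`; it is meaningful at the points `x` where
`ergodicSum F ψ x ≠ 0`. -/
noncomputable def ergodicRatio {G X : Type*} [SMul G X] (F : Finset G) (φ ψ : X → ℝ) (x : X) : ℝ :=
  ergodicSum F φ x / ergodicSum F ψ x

/-- A measure is non-atomic if every measurable set of positive measure has a measurable subset
of strictly smaller positive measure. (The class `NullSingletonClass`, which only says that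
points are null, is weaker on general measurable spaces.) -/
def IsNonatomic {X : Type*} [MeasurableSpace X] (μ : Measure X) : Prop :=
  ∀ s, MeasurableSet s → 0 < μ s → ∃ t ⊆ s, MeasurableSet t ∧ 0 < μ t ∧ μ t < μ s

/-!
The action is a `(C,F)`-action, that is, an infinite rank-one construction by cutting and stacking.
A tower (`Tower`) consists of finite sets `F n` of the group, each of which contains many disjoint
right translates `F n * c n i` of the preceding one, with room around them. A point of the space
is described by its position in `F n`, for all large `n`, where the position at level `n + 1` is the
position at level `n` multiplied by some `c n i`. So it is a germ at infinity of sequences in `G`,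
and `G` acts by left multiplication. If the copies are chosen independently and uniformly, then the
laws of these points add up to a σ-finite invariant measure (`Tower.measure`). An invariant set
corresponds to a tail event of the choices, so that the action is ergodic by Kolmogorov's zero-one
law (`Tower.measure_eq_zero_or_of_invariant`). There are no atoms because the cylinders of level `n`
have measure at most `2⁻ⁿ`.

The tower and the functions `φ`, `ψ` are built together. If the balls are strongly non-Besicovitch,
then a greedy selection and the pigeonhole principle provide arbitrarily many balls of radii `k m`
which have a common point while even the `l`-neighbourhood of each misses the centres of the others
(`IsStronglyNonBesicovitch.exists_separated`). Put copies of the finite set built so far, together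
with `φ` and `ψ` on it, at the centres, and give to `φ` the value `1` on a ball around the common
point. It is chosen so large that the balls of the given radii around all points of the copies meet
it in far more points than the mass of one copy. So each point of each copy sees in one ball, apart
from a negligible rest, only its own copy, no other one, and this new mass, and the ratio is at
least `2` there. As the number of copies is arbitrarily large compared to the new
mass, the latter adds arbitrarily little to the integral
(`IsStronglyNonBesicovitch.exists_stage`). With the roles of `φ` and `ψ` interchanged at every other
level, the ratios at every point that has a position from some level on are infinitely often
at least `2` and infinitely often at most `1 / 2`. A small positive value at all other places
keeps `ψ` positive.
-/

/-! ### Word balls -/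

section WordBall

variable {G : Type*} [Group G] [DecidableEq G] {A : Finset G}

theorem one_mem_wordBall (r : ℕ) : (1 : G) ∈ wordBall A r := by
  have := Finset.pow_mem_pow (s := insert (1 : G) A) (Finset.mem_insert_self 1 A) (n := r)
  simpa [wordBall] using this

theorem wordBall_add (r s : ℕ) : wordBall A (r + s) = wordBall A r * wordBall A s :=
  pow_add _ _ _

theorem mul_mem_wordBall {g h : G} {r s : ℕ} (hg : g ∈ wordBall A r) (hh : h ∈ wordBall A s) :
    g * h ∈ wordBall A (r + s) := by
  rw [wordBall_add]
  exact Finset.mul_mem_mul hg hh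

theorem wordBall_mono {r s : ℕ} (h : r ≤ s) : wordBall A r ⊆ wordBall A s :=
  Finset.pow_subset_pow_right (Finset.mem_insert_self 1 A) h

theorem inv_mem_wordBall (hsymm : A⁻¹ = A) {g : G} {r : ℕ} (hg : g ∈ wordBall A r) :
    g⁻¹ ∈ wordBall A r := by
  have h : (wordBall A r)⁻¹ = wordBall A r := by
    rw [wordBall, ← inv_pow, Finset.inv_insert, hsymm, inv_one]
  rw [← h]
  exact Finset.inv_mem_inv hg

theorem exists_mem_wordBall (hsymm : A⁻¹ = A) (hgen : Subgroup.closure (A : Set G) = ⊤) (g : G) :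
    ∃ r, g ∈ wordBall A r := by
  have hg : g ∈ Subgroup.closure (A : Set G) := by rw [hgen]; trivial
  induction hg using Subgroup.closure_induction with
  | mem x hx =>
    exact ⟨1, by rw [wordBall, pow_one]; exact Finset.mem_insert_of_mem hx⟩
  | one => exact ⟨0, one_mem_wordBall 0⟩
  | mul x y _ _ hx hy =>
    obtain ⟨r, hr⟩ := hx
    obtain ⟨s, hs⟩ := hy
    exact ⟨r + s, mul_mem_wordBall hr hs⟩
  | inv x _ hx =>
    obtain ⟨r, hr⟩ := hx
    exact ⟨r, inv_mem_wordBall hsymm hr⟩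

theorem countable_of_closure_eq_top (hsymm : A⁻¹ = A)
    (hgen : Subgroup.closure (A : Set G) = ⊤) : Countable G := by
  have h : (⋃ r, (wordBall A r : Set G)) = Set.univ :=
    Set.eq_univ_of_forall fun g => by simpa using exists_mem_wordBall hsymm hgen g
  rw [← Set.countable_univ_iff, ← h]
  exact Set.countable_iUnion fun r => (wordBall A r).countable_toSet

end WordBall

/-! ### Separated families of balls -/

section Separated

variable {G : Type*} [Group G] [DecidableEq G] {A : Finset G}

/-- Greedy selection: choosing centres in order of decreasing radius, and only those not covered
so far, produces a cover whose centres lie outside each other's neighbourhoods. -/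
theorem exists_separated_cover (hsymm : A⁻¹ = A) {l : ℕ} {E : Finset G} (hE : wordBall A l ⊆ E)
    (r : G → ℕ) (D : Finset G) :
    ∃ D' ⊆ D, (∀ a ∈ D, ∃ g ∈ D', a ∈ E * wordBall A (r g) * {g}) ∧
      ∀ g ∈ D', ∀ h ∈ D', g ≠ h → g * h⁻¹ ∉ wordBall A (l + r h) := by
  induction D using Finset.strongInduction with
  | H D ih =>
    rcases D.eq_empty_or_nonempty with rfl | hD
    · exact ⟨∅, by simp⟩
    obtain ⟨g, hg, hmax⟩ := D.exists_max_image r hD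
    have hcov : ∀ h s, r h = s → ∀ x, x * h⁻¹ ∈ wordBall A (l + s) →
        x ∈ E * wordBall A (r h) * {h} := by
      rintro h s rfl x hx
      rw [wordBall_add] at hx
      have hx' := Finset.mul_subset_mul_right (t := wordBall A (r h)) hE hx
      rw [Finset.mem_mul]
      exact ⟨_, hx', h, Finset.mem_singleton_self h, by group⟩
    set D₁ := D.filter fun x => x ∉ E * wordBall A (r g) * {g} with hD₁
    have hgD₁ : g ∉ D₁ := by
      simp only [hD₁, Finset.mem_filter, not_and, not_not]
      exact fun _ => hcov g _ rfl g (by simpa using one_mem_wordBall _)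
    have hss : D₁ ⊂ D :=
      Finset.ssubset_iff_subset_ne.2 ⟨Finset.filter_subset _ _, fun h => hgD₁ (h ▸ hg)⟩
    obtain ⟨D', hD', hc, hs⟩ := ih D₁ hss
    -- a point of `D₁` is far from `g`, in both orders since its radius is at most that of `g`
    have hfar : ∀ h ∈ D', h * g⁻¹ ∉ wordBall A (l + r g) := fun h hh hmem =>
      (Finset.mem_filter.1 (hD' hh)).2 (hcov g _ rfl h hmem)
    have hfar' : ∀ h ∈ D', g * h⁻¹ ∉ wordBall A (l + r h) := fun h hh hmem => by
      refine hfar h hh ?_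
      have := inv_mem_wordBall hsymm hmem
      rw [mul_inv_rev, inv_inv] at this
      exact wordBall_mono (Nat.add_le_add_left (hmax h (hss.1 (hD' hh))) l) this
    refine ⟨insert g D', Finset.insert_subset hg (hD'.trans hss.1), ?_, ?_⟩
    · intro a ha
      by_cases hag : a ∈ E * wordBall A (r g) * {g}
      · exact ⟨g, Finset.mem_insert_self _ _, hag⟩
      · obtain ⟨h, hh, hah⟩ := hc a (Finset.mem_filter.2 ⟨ha, hag⟩)
        exact ⟨h, Finset.mem_insert_of_mem hh, hah⟩
    · intro a ha b hb hab
      rcases Finset.mem_insert.1 ha with rfl | ha' <;> rcases Finset.mem_insert.1 hb with rfl | hb'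
      · exact (hab rfl).elim
      · exact hfar' b hb'
      · exact hfar a ha'
      · exact hs a ha' b hb' hab

/-- If the balls of radii `k n` are strongly non-Besicovitch, there are arbitrarily many of them,
with arbitrarily remote centres, which all contain `1` and such that even the `l`-neighbourhood
of each misses the other centres. -/
theorem IsStronglyNonBesicovitch.exists_separated (hsymm : A⁻¹ = A)
    {k : ℕ → ℕ} (hF : IsStronglyNonBesicovitch fun n => wordBall A (k n)) (l N R : ℕ) :
    ∃ (c : Fin N → G) (m : Fin N → ℕ),
      (∀ i, c i ∈ wordBall A (k (m i))) ∧ (∀ i, c i ∉ wordBall A R) ∧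
      ∀ i j, i ≠ j → c i * (c j)⁻¹ ∉ wordBall A (l + k (m j)) := by
  obtain ⟨E, hE, -, hnot⟩ := hF (wordBall A l)
  simp only [IsBesicovitch, not_exists, not_forall, not_and, not_le] at hnot
  obtain ⟨D, n, hDn⟩ := hnot (E.card * (N + (wordBall A R).card))
  obtain ⟨D', hD', hc, hs⟩ := exists_separated_cover hsymm hE (fun g => k (n g)) D
  obtain ⟨x, hx⟩ := hDn D' hD' hc
  set T := D'.filter fun g => x ∈ E * wordBall A (k (n g)) * {g} with hT
  have hTx : ∀ g ∈ T, ∃ e ∈ E, e⁻¹ * x * g⁻¹ ∈ wordBall A (k (n g)) := by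
    intro g hg
    have hg' := (Finset.mem_filter.1 hg).2
    rw [Finset.mem_mul] at hg'
    obtain ⟨y, hy, g', hg', rfl⟩ := hg'
    rw [Finset.mem_singleton] at hg'
    subst hg'
    obtain ⟨e, he, b, hb, rfl⟩ := Finset.mem_mul.1 hy
    exact ⟨e, he, by simpa [mul_assoc] using hb⟩
  choose! e heE he using hTx
  obtain ⟨e₀, -, hcard⟩ := Finset.exists_lt_card_fiber_of_mul_lt_card_of_maps_to heE hx
  -- the common point `e₀⁻¹ * x` of the balls of the fibre is translated to `1`
  set S := (T.filter fun g => e g = e₀).image fun g => g * (e₀⁻¹ * x)⁻¹ with hS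
  have hinj : Function.Injective fun g : G => g * (e₀⁻¹ * x)⁻¹ := mul_left_injective _
  have hScard : N ≤ (S \ wordBall A R).card := by
    have h1 := Finset.le_card_sdiff (wordBall A R) S
    rw [hS, Finset.card_image_of_injective _ hinj, ← hS] at h1
    omega
  obtain ⟨U, hUS, hUcard⟩ := Finset.exists_subset_card_eq hScard
  let c : Fin N → G := fun i => (U.equivFinOfCardEq hUcard).symm i
  have hcU : ∀ i, c i ∈ U := fun i => ((U.equivFinOfCardEq hUcard).symm i).2
  have hcinj : Function.Injective c :=
    Subtype.val_injective.comp (U.equivFinOfCardEq hUcard).symm.injective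
  have hex : ∀ i, ∃ g ∈ T, e g = e₀ ∧ g * (e₀⁻¹ * x)⁻¹ = c i := by
    intro i
    have := (Finset.mem_sdiff.1 (hUS (hcU i))).1
    simp only [hS, Finset.mem_image, Finset.mem_filter] at this
    obtain ⟨g, ⟨hg, hge⟩, hgc⟩ := this
    exact ⟨g, hg, hge, hgc⟩
  choose g hgT hge hgc using hex
  refine ⟨c, fun i => n (g i), fun i => ?_, fun i => (Finset.mem_sdiff.1 (hUS (hcU i))).2, ?_⟩
  · have := inv_mem_wordBall hsymm (he _ (hgT i))
    rw [hge] at this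
    rw [← hgc]
    simpa [mul_assoc] using this
  · intro i j hij hmem
    have hne : g i ≠ g j := fun h => hij (hcinj (by rw [← hgc, ← hgc, h]))
    refine hs _ (Finset.mem_filter.1 (hgT i)).1 _ (Finset.mem_filter.1 (hgT j)).1 hne ?_
    rw [← hgc, ← hgc] at hmem
    simpa [mul_assoc] using hmem

theorem IsStronglyNonBesicovitch.exists_card_le (hsymm : A⁻¹ = A)
    {k : ℕ → ℕ} (hF : IsStronglyNonBesicovitch fun n => wordBall A (k n)) (N : ℕ) :
    ∃ t, N ≤ (wordBall A t).card := by
  obtain ⟨c, m, hc, -, hs⟩ := hF.exists_separated hsymm 0 N 0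
  have hinj : Function.Injective c := fun i j hij => by
    by_contra hne
    exact hs i j hne (by rw [hij, mul_inv_cancel]; exact one_mem_wordBall _)
  refine ⟨Finset.univ.sup fun i => k (m i), ?_⟩
  calc N = (Finset.univ.image c).card := by
        rw [Finset.card_image_of_injective _ hinj, Finset.card_univ, Fintype.card_fin]
    _ ≤ _ := Finset.card_le_card fun x hx => by
        obtain ⟨i, -, rfl⟩ := Finset.mem_image.1 hx
        exact wordBall_mono (Finset.le_sup (f := fun i => k (m i)) (Finset.mem_univ i)) (hc i)

end Separated

/-! ### One step of the inductive construction -/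

section Stage

variable {G : Type*} [Group G] [DecidableEq G] {A : Finset G}

/-- One step of the construction. The functions `p` and `q` on the ball of radius `l` are copied to
`N + 1` disjoint translates of that ball, and extended to a larger ball with an additional mass
that is small compared to `N + 1`. The value `1` of `p'` on a ball around `1`, which is met by a
ball of suitable radius around any point of any copy, makes that point see at least twice as much
of `p'` as of `q'`. -/
theorem IsStronglyNonBesicovitch.exists_stage (hsymm : A⁻¹ = A)
    {k : ℕ → ℕ} (hF : IsStronglyNonBesicovitch fun n => wordBall A (k n)) (n l : ℕ)
    (p q : G → ℝ) (hp : ∀ g, 0 < p g ∧ p g ≤ 1) (hq : ∀ g, 0 < q g ∧ q g ≤ 1) :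
    ∃ (l' N : ℕ) (c : Fin (N + 1) → G) (p' q' : G → ℝ),
      (∀ g, 0 < p' g ∧ p' g ≤ 1) ∧ (∀ g, 0 < q' g ∧ q' g ≤ 1) ∧ 1 ≤ N ∧
      (∀ f ∈ wordBall A l, ∀ f' ∈ wordBall A l, ∀ i j, f * c i = f' * c j → f = f' ∧ i = j) ∧
      (∀ g ∈ wordBall A n, ∀ f ∈ wordBall A l, ∀ i, g * (f * c i) ∈ wordBall A l') ∧
      (∀ f ∈ wordBall A l, ∀ i, p' (f * c i) = p f ∧ q' (f * c i) = q f) ∧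
      ∑ h ∈ wordBall A l' \ Finset.image₂ (fun f i => f * c i) (wordBall A l) Finset.univ,
        (p' h + q' h) ≤ (N + 1) * (1 / 2) ^ n ∧
      ∀ f ∈ wordBall A l, ∀ i, ∃ m, n < k m ∧
        (∀ g ∈ wordBall A (k m), g * (f * c i) ∈ wordBall A l') ∧
        2 * ∑ g ∈ wordBall A (k m), q' (g * (f * c i)) ≤
          ∑ g ∈ wordBall A (k m), p' (g * (f * c i)) := by
  -- `p'` will be `1` on `S`, which contains the ball of radius `t` around every point of `B_{l + t}`;
  -- one such ball, of at least `2 * (M + 1)` points, lies in the ball used around each point of the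
  -- copies, and `N` is chosen large compared to the mass of `S`
  set M := ∑ f ∈ wordBall A l, q f
  obtain ⟨t, ht⟩ := hF.exists_card_le hsymm ⌈2 * (M + 1)⌉₊
  replace ht : 2 * (M + 1) ≤ (wordBall A t).card := (Nat.le_ceil _).trans (by exact_mod_cast ht)
  set S := wordBall A (l + 2 * t) with hS
  set N := (S.card + 2) * 2 ^ n with hN
  obtain ⟨c, m, hc, hcR, hsep⟩ := hF.exists_separated hsymm (2 * l) (N + 1) (n + 2 * l + 2 * t)
  have hm : ∀ i, n + 2 * l + 2 * t < k (m i) := fun i => by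
    by_contra! h
    exact hcR i (wordBall_mono h (hc i))
  set K := Finset.univ.sup fun i => k (m i)
  have hK : ∀ i, k (m i) ≤ K := fun i => Finset.le_sup (f := fun i => k (m i)) (Finset.mem_univ i)
  set l' := n + l + 2 * K + 2 * t
  -- the tiny positive value on the remaining points, of total mass at most `1`
  set τ : ℝ := 1 / ((wordBall A l').card + 1) with hτ
  have hτ0 : 0 < τ := by positivity
  have hτ1 : τ ≤ 1 := by
    rw [hτ, div_le_one (by positivity)]
    linarith [Nat.cast_nonneg (α := ℝ) (wordBall A l').card]
  have hτs : ∀ s ⊆ wordBall A l', (s.card : ℝ) * τ ≤ 1 := fun s hs => by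
    have : (s.card : ℝ) ≤ (wordBall A l').card := by exact_mod_cast Finset.card_le_card hs
    rw [hτ, mul_one_div, div_le_one (by positivity)]
    linarith
  have hinj : ∀ f ∈ wordBall A l, ∀ f' ∈ wordBall A l, ∀ i j,
      f * c i = f' * c j → f = f' ∧ i = j := by
    intro f hf f' hf' i j h
    have hij : i = j := by
      by_contra hij
      refine hsep i j hij (wordBall_mono (r := l + l) (by omega) ?_)
      have : c i * (c j)⁻¹ = f⁻¹ * f' := by
        rw [mul_inv_eq_iff_eq_mul, mul_assoc, ← h, inv_mul_cancel_left]
      rw [this]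
      exact mul_mem_wordBall (inv_mem_wordBall hsymm hf) hf'
    subst hij
    exact ⟨mul_right_cancel h, rfl⟩
  let e : {f // f ∈ wordBall A l} × Fin (N + 1) → G := fun x => x.1 * c x.2
  have he : Function.Injective e := fun x y hxy => by
    obtain ⟨h1, h2⟩ := hinj _ x.1.2 _ y.1.2 _ _ hxy
    exact Prod.ext (Subtype.ext h1) h2
  let p' : G → ℝ := Function.extend e (fun x => p x.1) fun h => if h ∈ S then 1 else τ
  let q' : G → ℝ := Function.extend e (fun x => q x.1) fun _ => τ
  have hpe : ∀ f ∈ wordBall A l, ∀ i, p' (f * c i) = p f := fun f hf i =>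
    he.extend_apply (fun x => p x.1) _ (⟨f, hf⟩, i)
  have hqe : ∀ f ∈ wordBall A l, ∀ i, q' (f * c i) = q f := fun f hf i =>
    he.extend_apply (fun x => q x.1) _ (⟨f, hf⟩, i)
  have hpn : ∀ h, (¬ ∃ x, e x = h) → p' h = if h ∈ S then 1 else τ := fun h hh =>
    Function.extend_apply' _ _ _ hh
  have hqn : ∀ h, (¬ ∃ x, e x = h) → q' h = τ := fun h hh => Function.extend_apply' _ _ _ hh
  have hSc : ∀ h ∈ S, ¬ ∃ x, e x = h := by
    rintro h hh ⟨⟨f, i⟩, rfl⟩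
    refine hcR i (wordBall_mono (r := l + (l + 2 * t)) (by omega) ?_)
    rw [show c i = (f.1)⁻¹ * (f.1 * c i) by group]
    exact mul_mem_wordBall (inv_mem_wordBall hsymm f.2) hh
  refine ⟨l', N, c, p', q', ?_, ?_, ?_, hinj, ?_, fun f hf i => ⟨hpe f hf i, hqe f hf i⟩, ?_, ?_⟩
  · intro g
    by_cases hg : ∃ x, e x = g
    · obtain ⟨x, rfl⟩ := hg
      rw [show p' (e x) = p x.1 from hpe _ x.1.2 _]
      exact hp _
    · rw [hpn g hg]
      split_ifs
      · simp
      · exact ⟨hτ0, hτ1⟩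
  · intro g
    by_cases hg : ∃ x, e x = g
    · obtain ⟨x, rfl⟩ := hg
      rw [show q' (e x) = q x.1 from hqe _ x.1.2 _]
      exact hq _
    · rw [hqn g hg]
      exact ⟨hτ0, hτ1⟩
  · exact Nat.succ_le_of_lt (by positivity)
  · intro g hg f hf i
    refine wordBall_mono ?_ (mul_mem_wordBall hg (mul_mem_wordBall hf (hc i)))
    have := hK i
    omega
  · set W := wordBall A l' \ Finset.image₂ (fun f i => f * c i) (wordBall A l) Finset.univ
    have hW : ∀ h ∈ W, p' h + q' h ≤ (if h ∈ S then 1 else 0) + 2 * τ := by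
      intro h hh
      have hne : ¬ ∃ x, e x = h := by
        rintro ⟨x, rfl⟩
        exact (Finset.mem_sdiff.1 hh).2 (Finset.mem_image₂_of_mem x.1.2 (Finset.mem_univ _))
      rw [hpn h hne, hqn h hne]
      split_ifs <;> linarith
    have hWS : (∑ h ∈ W, if h ∈ S then (1 : ℝ) else 0) ≤ S.card := by
      rw [Finset.sum_boole]
      exact_mod_cast Finset.card_le_card fun h hh => (Finset.mem_filter.1 hh).2
    calc ∑ h ∈ W, (p' h + q' h) ≤ ∑ h ∈ W, ((if h ∈ S then (1 : ℝ) else 0) + 2 * τ) :=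
          Finset.sum_le_sum hW
      _ = (∑ h ∈ W, if h ∈ S then (1 : ℝ) else 0) + 2 * (W.card * τ) := by
          rw [Finset.sum_add_distrib, Finset.sum_const, nsmul_eq_mul]; ring
      _ ≤ S.card + 2 * 1 := by
          have := hτs W Finset.sdiff_subset
          linarith
      _ = N * (1 / 2) ^ n := by
          rw [hN]; push_cast
          rw [mul_assoc, ← mul_pow]; norm_num
      _ ≤ (N + 1) * (1 / 2) ^ n := by gcongr; linarith
  · intro f hf j
    set r := k (m j)
    have hrl' : r ≤ l' := by have := hK j; omega
    refine ⟨m j, by have := hm j; omega, fun g hg => ?_, ?_⟩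
    · refine wordBall_mono ?_ (mul_mem_wordBall hg (mul_mem_wordBall hf (hc j)))
      have := hK j
      omega
    -- the ball around `f * c j` meets no other copy, so `q'` contributes at most `M + 1`
    have hq1 : ∀ g ∈ wordBall A r,
        q' (g * (f * c j)) ≤ (if g * f ∈ wordBall A l then q (g * f) else 0) + τ := by
      intro g hg
      by_cases hx : ∃ x, e x = g * (f * c j)
      · obtain ⟨⟨f', i⟩, hx⟩ := hx
        have hij : i = j := by
          by_contra hij
          refine hsep i j hij (wordBall_mono (r := l + (r + l)) (by omega) ?_)
          have : c i * (c j)⁻¹ = (f'.1)⁻¹ * (g * f) := by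
            rw [mul_inv_eq_iff_eq_mul, mul_assoc, mul_assoc g, ← hx]
            exact (inv_mul_cancel_left _ _).symm
          rw [this]
          exact mul_mem_wordBall (inv_mem_wordBall hsymm f'.2) (mul_mem_wordBall hg hf)
        subst hij
        have hf' : f'.1 = g * f := mul_right_cancel (hx.trans (mul_assoc _ _ _).symm)
        rw [← hf', if_pos f'.2, ← hx, show q' (e (f', i)) = q f' from hqe _ f'.2 _]
        linarith
      · rw [hqn _ hx]
        split_ifs
        · linarith [(hq (g * f)).1]
        · linarith
    have hq2 : (∑ g ∈ wordBall A r, if g * f ∈ wordBall A l then q (g * f) else 0) ≤ M := by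
      rw [← Finset.sum_filter, ← Finset.sum_image (f := q) (g := fun g => g * f)
        (fun x _ y _ h => mul_left_injective f h)]
      refine Finset.sum_le_sum_of_subset_of_nonneg (fun x hx => ?_) fun x _ _ => (hq x).1.le
      obtain ⟨g, hg, rfl⟩ := Finset.mem_image.1 hx
      exact (Finset.mem_filter.1 hg).2
    have hq3 : ∑ g ∈ wordBall A r, q' (g * (f * c j)) ≤ M + 1 := by
      refine (Finset.sum_le_sum hq1).trans ?_
      rw [Finset.sum_add_distrib, Finset.sum_const, nsmul_eq_mul]
      have := hτs _ (wordBall_mono (A := A) hrl')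
      linarith
    -- a geodesic from `f * c j` towards `1`, stopped `t` steps before its end
    obtain ⟨u, hu, b, hb, hub⟩ : ∃ u ∈ wordBall A (l + t), ∃ b ∈ wordBall A (r - t),
        u * b = (f * c j)⁻¹ := by
      rw [← Finset.mem_mul, ← wordBall_add,
        show l + t + (r - t) = l + r by have := hm j; omega]
      exact inv_mem_wordBall hsymm (mul_mem_wordBall hf (hc j))
    have hbu : b * (f * c j) = u⁻¹ := by
      rw [eq_inv_of_mul_eq_one_right (a := u) (b := b * (f * c j))]
      rw [← mul_assoc, hub, inv_mul_cancel]
    have hp1 : ((wordBall A t).card : ℝ) ≤ ∑ g ∈ wordBall A r, p' (g * (f * c j)) := by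
      calc ((wordBall A t).card : ℝ) = ∑ g ∈ wordBall A t, p' (g * b * (f * c j)) := by
            rw [Finset.card_eq_sum_ones, Nat.cast_sum]
            refine Finset.sum_congr rfl fun g hg => ?_
            have hmem : g * b * (f * c j) ∈ S := by
              rw [mul_assoc, hbu]
              refine wordBall_mono (r := t + (l + t)) (by omega) ?_
              exact mul_mem_wordBall hg (inv_mem_wordBall hsymm hu)
            rw [hpn _ (hSc _ hmem), if_pos hmem, Nat.cast_one]
        _ = ∑ g ∈ (wordBall A t).image (fun g => g * b), p' (g * (f * c j)) :=
            (Finset.sum_image (f := fun g => p' (g * (f * c j)))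
              fun x _ y _ h => mul_left_injective b h).symm
        _ ≤ _ := by
            refine Finset.sum_le_sum_of_subset_of_nonneg (fun x hx => ?_) fun x _ _ => ?_
            · obtain ⟨g, hg, rfl⟩ := Finset.mem_image.1 hx
              refine wordBall_mono (r := t + (r - t)) ?_ (mul_mem_wordBall hg hb)
              have := hm j
              omega
            · by_cases hx : ∃ y, e y = x * (f * c j)
              · obtain ⟨y, hy⟩ := hx
                rw [← hy, show p' (e y) = p y.1 from hpe _ y.1.2 _]
                exact (hp _).1.le
              · rw [hpn _ hx]
                split_ifs <;> linarith
    linarith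

end Stage

/-! ### Towers of finite sets and their inductive construction -/

/-- The data of a `(C,F)`-action of the group `G`: finite sets `F n`, and for each `n` a finite
set of at least two elements `c n i` such that the translates `F n * c n i` are disjoint subsets
of `F (n + 1)` that are, for large `n`, surrounded within `F (n + 1)` by any prescribed
neighbourhood. -/
structure Tower (G : Type*) [Group G] where
  /-- The finite set of positions at level `n`. -/
  F : ℕ → Finset G
  /-- One less than the number of copies of level `n` in level `n + 1`. -/
  N : ℕ → ℕ
  /-- The positions of the copies of level `n` in level `n + 1`. -/
  c : ∀ n, Fin (N n + 1) → G
  one_le_N : ∀ n, 1 ≤ N n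
  nonempty : (F 0).Nonempty
  mul_mem : ∀ {n f}, f ∈ F n → ∀ i, f * c n i ∈ F (n + 1)
  inj : ∀ {n f f'}, f ∈ F n → f' ∈ F n → ∀ {i j}, f * c n i = f' * c n j → f = f' ∧ i = j
  absorb : ∀ g, ∀ᶠ n in atTop, ∀ f ∈ F n, ∀ i, g * (f * c n i) ∈ F (n + 1)

namespace Tower

variable {G : Type*} [Group G] [DecidableEq G]

/-- The positions at level `n` that do not belong to a copy of the preceding level. -/
def spacer (T : Tower G) : ℕ → Finset G
  | 0 => T.F 0
  | n + 1 => T.F (n + 1) \ Finset.image₂ (fun f i => f * T.c n i) (T.F n) Finset.univ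

/-- A sequence of positive functions bounded by `1`, the one at level `n + 1` extending the copies
of the one at level `n`, whose total mass, relative to the number of copies, is summable. -/
structure IsDensity (T : Tower G) (p : ℕ → G → ℝ) : Prop where
  pos : ∀ n g, 0 < p n g
  le_one : ∀ n g, p n g ≤ 1
  step : ∀ n, ∀ f ∈ T.F n, ∀ i, p (n + 1) (f * T.c n i) = p n f
  sum_le : ∀ n, ∑ h ∈ T.spacer (n + 1), p (n + 1) h ≤ (T.N n + 1) * (1 / 2) ^ n

end Tower

theorem IsStronglyNonBesicovitch.exists_tower {G : Type*} [Group G] [DecidableEq G] {A : Finset G}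
    (hsymm : A⁻¹ = A) (hgen : Subgroup.closure (A : Set G) = ⊤)
    {k : ℕ → ℕ} (hF : IsStronglyNonBesicovitch fun n => wordBall A (k n)) :
    ∃ (T : Tower G) (p q : ℕ → G → ℝ), T.IsDensity p ∧ T.IsDensity q ∧
      ∀ n, ∀ f ∈ T.F n, ∀ i, ∃ m, n < k m ∧
        (∀ g ∈ wordBall A (k m), g * (f * T.c n i) ∈ T.F (n + 1)) ∧
        (Even n → 2 * ∑ g ∈ wordBall A (k m), q (n + 1) (g * (f * T.c n i)) ≤
          ∑ g ∈ wordBall A (k m), p (n + 1) (g * (f * T.c n i))) ∧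
        (¬ Even n → 2 * ∑ g ∈ wordBall A (k m), p (n + 1) (g * (f * T.c n i)) ≤
          ∑ g ∈ wordBall A (k m), q (n + 1) (g * (f * T.c n i))) := by
  let State := {s : ℕ × (G → ℝ) × (G → ℝ) //
    (∀ g, 0 < s.2.1 g ∧ s.2.1 g ≤ 1) ∧ ∀ g, 0 < s.2.2 g ∧ s.2.2 g ≤ 1}
  have key : ∀ (n : ℕ) (s : State), ∃ (N : ℕ) (c : Fin (N + 1) → G) (s' : State), 1 ≤ N ∧
      (∀ f ∈ wordBall A s.1.1, ∀ f' ∈ wordBall A s.1.1, ∀ i j,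
        f * c i = f' * c j → f = f' ∧ i = j) ∧
      (∀ g ∈ wordBall A n, ∀ f ∈ wordBall A s.1.1, ∀ i, g * (f * c i) ∈ wordBall A s'.1.1) ∧
      (∀ f ∈ wordBall A s.1.1, ∀ i, s'.1.2.1 (f * c i) = s.1.2.1 f ∧
        s'.1.2.2 (f * c i) = s.1.2.2 f) ∧
      ∑ h ∈ wordBall A s'.1.1 \
          Finset.image₂ (fun f i => f * c i) (wordBall A s.1.1) Finset.univ,
        (s'.1.2.1 h + s'.1.2.2 h) ≤ (N + 1) * (1 / 2) ^ n ∧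
      ∀ f ∈ wordBall A s.1.1, ∀ i, ∃ m, n < k m ∧
        (∀ g ∈ wordBall A (k m), g * (f * c i) ∈ wordBall A s'.1.1) ∧
        (Even n → 2 * ∑ g ∈ wordBall A (k m), s'.1.2.2 (g * (f * c i)) ≤
          ∑ g ∈ wordBall A (k m), s'.1.2.1 (g * (f * c i))) ∧
        (¬ Even n → 2 * ∑ g ∈ wordBall A (k m), s'.1.2.1 (g * (f * c i)) ≤
          ∑ g ∈ wordBall A (k m), s'.1.2.2 (g * (f * c i))) := by
    rintro n ⟨⟨l, p, q⟩, hp, hq⟩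
    by_cases hn : Even n
    · obtain ⟨l', N, c, p', q', hp', hq', hN, h1, h2, h3, h4, h5⟩ :=
        hF.exists_stage hsymm n l p q hp hq
      refine ⟨N, c, ⟨(l', p', q'), hp', hq'⟩, hN, h1, h2, h3, h4, fun f hf i => ?_⟩
      obtain ⟨m, hm1, hm2, hm3⟩ := h5 f hf i
      exact ⟨m, hm1, hm2, fun _ => hm3, fun h => (h hn).elim⟩
    · obtain ⟨l', N, c, q', p', hq', hp', hN, h1, h2, h3, h4, h5⟩ :=
        hF.exists_stage hsymm n l q p hq hp
      refine ⟨N, c, ⟨(l', p', q'), hp', hq'⟩, hN, h1, h2, fun f hf i => (h3 f hf i).symm,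
        by simpa only [add_comm] using h4, fun f hf i => ?_⟩
      obtain ⟨m, hm1, hm2, hm3⟩ := h5 f hf i
      exact ⟨m, hm1, hm2, fun h => (hn h).elim, fun _ => hm3⟩
  choose N c next hN h1 h2 h3 h4 h5 using key
  let s : ℕ → State := fun n => Nat.rec ⟨(0, 1, 1), by simp, by simp⟩ next n
  have hs : ∀ n, s (n + 1) = next n (s n) := fun n => rfl
  let T : Tower G :=
    { F := fun n => wordBall A (s n).1.1
      N := fun n => N n (s n)
      c := fun n => c n (s n)
      one_le_N := fun n => hN n (s n)
      nonempty := ⟨1, one_mem_wordBall _⟩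
      mul_mem := fun {n f} hf i => by
        simpa only [one_mul] using h2 n (s n) 1 (one_mem_wordBall _) f hf i
      inj := fun {n f f'} hf hf' {i j} h => h1 n (s n) f hf f' hf' i j h
      absorb := fun g => by
        obtain ⟨r, hr⟩ := exists_mem_wordBall hsymm hgen g
        filter_upwards [eventually_ge_atTop r] with n hn f hf i
        exact h2 n (s n) g (wordBall_mono hn hr) f hf i }
  refine ⟨T, fun n => (s n).1.2.1, fun n => (s n).1.2.2, ?_, ?_, fun n => h5 n (s n)⟩
  · refine ⟨fun n g => ((s n).2.1 g).1, fun n g => ((s n).2.1 g).2,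
      fun n f hf i => (h3 n (s n) f hf i).1, fun n => le_trans ?_ (h4 n (s n))⟩
    exact Finset.sum_le_sum fun h _ => le_add_of_nonneg_right ((s (n + 1)).2.2 h).1.le
  · refine ⟨fun n g => ((s n).2.2 g).1, fun n g => ((s n).2.2 g).2,
      fun n f hf i => (h3 n (s n) f hf i).2, fun n => le_trans ?_ (h4 n (s n))⟩
    exact Finset.sum_le_sum fun h _ => le_add_of_nonneg_left ((s (n + 1)).2.1 h).1.le

/-! ### The space of a tower -/

namespace Tower

variable {G : Type*} [Group G] (T : Tower G)

/-- A sequence of choices of one copy at every level. -/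
abbrev Code : Type := ∀ i, Fin (T.N i + 1)

/-- The position `f * c n (ω n) * ⋯ * c (m - 1) (ω (m - 1))` at level `m` of the position `f` at
level `n` in the copies given by `ω`; for `m < n` it is `f` by convention. -/
def path (n : ℕ) (f : G) (ω : T.Code) : ℕ → G
  | 0 => f
  | m + 1 => if m < n then f else path n f ω m * T.c m (ω m)

variable {T} {n m j : ℕ} {f f' : G} {ω ω' : T.Code}

theorem path_of_le (h : m ≤ n) : T.path n f ω m = f := by
  cases m with
  | zero => rfl
  | succ m => exact if_pos h

theorem path_succ (h : n ≤ m) : T.path n f ω (m + 1) = T.path n f ω m * T.c m (ω m) :=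
  if_neg h.not_gt

theorem path_path (h : n ≤ m) (hj : m ≤ j) :
    T.path m (T.path n f ω m) ω j = T.path n f ω j := by
  induction j, hj using Nat.le_induction with
  | base => exact path_of_le le_rfl
  | succ j hj ih => rw [path_succ hj, path_succ (h.trans hj), ih]

theorem path_mem (hf : f ∈ T.F n) (h : n ≤ m) : T.path n f ω m ∈ T.F m := by
  induction m, h using Nat.le_induction with
  | base => rwa [path_of_le le_rfl]
  | succ m h ih => rw [path_succ h]; exact T.mul_mem ih _

theorem path_mul (g : G) : T.path n (g * f) ω m = g * T.path n f ω m := by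
  induction m with
  | zero => rfl
  | succ m ih =>
    rcases lt_or_ge m n with h | h
    · rw [path_of_le h, path_of_le h]
    · rw [path_succ h, path_succ h, ih, mul_assoc]

theorem path_congr (h : ∀ i, n ≤ i → i < m → ω i = ω' i) :
    T.path n f ω m = T.path n f ω' m := by
  induction m with
  | zero => rfl
  | succ m ih =>
    rcases lt_or_ge m n with hm | hm
    · rw [path_of_le hm, path_of_le hm]
    · rw [path_succ hm, path_succ hm, h m hm m.lt_succ_self,
        ih fun i hi hi' => h i hi (hi'.trans m.lt_succ_self)]

theorem path_injective (hf : f ∈ T.F n) (hf' : f' ∈ T.F n) (h : n ≤ m)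
    (heq : T.path n f ω m = T.path n f' ω' m) : f = f' := by
  induction m, h using Nat.le_induction with
  | base => rwa [path_of_le le_rfl, path_of_le le_rfl] at heq
  | succ m h ih =>
    rw [path_succ h, path_succ h] at heq
    exact ih (T.inj (path_mem hf h) (path_mem hf' h) heq).1

/-- Paths through the finite sets of the tower that meet at some level meet at every earlier level
at which both are defined. -/
theorem path_eq_of_le {n' : ℕ} (hf : f ∈ T.F n) (hf' : f' ∈ T.F n') (hn : n ≤ m) (hn' : n' ≤ m)
    (hj : m ≤ j) (heq : T.path n f ω j = T.path n' f' ω' j) :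
    T.path n f ω m = T.path n' f' ω' m := by
  rw [← path_path hn hj, ← path_path hn' hj] at heq
  exact path_injective (path_mem hf hn) (path_mem hf' hn') hj heq

theorem measurableSet_path (n : ℕ) (f : G) (m : ℕ) (S : Set G) :
    MeasurableSet {ω : T.Code | T.path n f ω m ∈ S} := by
  induction m generalizing S with
  | zero => exact MeasurableSet.const (f ∈ S)
  | succ m ih =>
    rcases lt_or_ge m n with hm | hm
    · simp only [path_of_le (T := T) (Nat.succ_le_of_lt hm)]
      exact MeasurableSet.const (f ∈ S)
    · have : {ω : T.Code | T.path n f ω (m + 1) ∈ S} =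
          ⋃ i, {ω | T.path n f ω m ∈ {g | g * T.c m i ∈ S}} ∩ (fun ω => ω m) ⁻¹' {i} := by
        ext ω
        simp [path_succ hm]
      rw [this]
      exact .iUnion fun i => (ih _).inter (measurable_pi_apply m (measurableSet_singleton i))

variable (T) [Small.{0} G]

/-- The space of a tower: germs at infinity of sequences of elements of `G`, of which only those
that eventually follow the copies of the tower will matter. The group acts from the left.
The elements of `G` are replaced by those of `Shrink G` to have the space in `Type`. -/
def Space (_ : Tower G) : Type := Germ (atTop : Filter ℕ) (Shrink.{0} G)

noncomputable instance : MulAction G T.Space :=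
  inferInstanceAs (MulAction G (Germ (atTop : Filter ℕ) (Shrink.{0} G)))

/-- The germ of a sequence. -/
noncomputable def germ (s : ℕ → G) : T.Space :=
  ((fun m => equivShrink G (s m) : ℕ → Shrink.{0} G) : Germ (atTop : Filter ℕ) (Shrink.{0} G))

/-- The point with position `f` at level `n` and code `ω` from level `n` on. -/
noncomputable def point (n : ℕ) (f : G) (ω : T.Code) : T.Space := T.germ (T.path n f ω)

/-- The finest σ-algebra for which all the maps `T.point n f` are measurable. -/
noncomputable instance : MeasurableSpace T.Space :=
  ⨅ x : ℕ × G, (inferInstance : MeasurableSpace T.Code).map (T.point x.1 x.2)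

variable {T}

theorem germ_eq_germ {s s' : ℕ → G} : T.germ s = T.germ s' ↔ s =ᶠ[atTop] s' := by
  refine Germ.coe_eq.trans ?_
  simp only [Filter.EventuallyEq, (equivShrink G).apply_eq_iff_eq]

theorem smul_germ (g : G) (s : ℕ → G) : g • T.germ s = T.germ fun m => g * s m := by
  refine congrArg (fun u : ℕ → Shrink.{0} G => (u : Germ (atTop : Filter ℕ) (Shrink.{0} G)))
    (funext fun m => ?_)
  exact (equivShrink_smul g (s m)).symm

theorem smul_point (g : G) : g • T.point n f ω = T.point n (g * f) ω := by
  rw [point, smul_germ, point]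
  exact congrArg T.germ (funext fun m => (path_mul g).symm)

theorem point_path (h : n ≤ m) : T.point m (T.path n f ω m) ω = T.point n f ω :=
  germ_eq_germ.2 ((eventually_ge_atTop m).mono fun _ hj => path_path h hj)

theorem point_succ : T.point (n + 1) (f * T.c n (ω n)) ω = T.point n f ω := by
  rw [← point_path (n := n) n.le_succ, path_succ le_rfl, path_of_le le_rfl]

theorem point_congr (h : ∀ i, n ≤ i → ω i = ω' i) : T.point n f ω = T.point n f ω' := by
  rw [point, point]
  congr 1
  funext m
  exact path_congr fun i hi _ => h i hi

/-- Equal points have equal positions at every level at which both are defined. -/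
theorem path_eq_of_point_eq {n' : ℕ} (hf : f ∈ T.F n) (hf' : f' ∈ T.F n') (hn : n ≤ m)
    (hn' : n' ≤ m) (h : T.point n f ω = T.point n' f' ω') :
    T.path n f ω m = T.path n' f' ω' m := by
  obtain ⟨j, hj, hmj⟩ := ((germ_eq_germ.1 h).and (eventually_ge_atTop m)).exists
  exact path_eq_of_le hf hf' hn hn' hmj hj

theorem measurableSet_space {S : Set T.Space} :
    MeasurableSet S ↔ ∀ n f, MeasurableSet (T.point n f ⁻¹' S) := by
  refine MeasurableSpace.measurableSet_iInf.trans ?_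
  simp only [Prod.forall]
  rfl

theorem measurable_point (n : ℕ) (f : G) : Measurable (T.point n f) :=
  fun _ hS => measurableSet_space.1 hS n f

theorem measurable_of_comp_point {β : Type*} [MeasurableSpace β] {φ : T.Space → β}
    (h : ∀ n f, Measurable (φ ∘ T.point n f)) : Measurable φ :=
  fun _ hB => measurableSet_space.2 fun n f => h n f hB

instance : MeasurableConstSMul G T.Space where
  measurable_const_smul g := measurable_of_comp_point fun n f => by
    have : (fun x : T.Space => g • x) ∘ T.point n f = T.point n (g * f) := by
      funext ω
      exact smul_point g
    rw [this]
    exact measurable_point _ _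

variable (T) in
/-- The points with position `f` at level `n`. -/
def cylinder (n : ℕ) (f : G) : Set T.Space := Set.range (T.point n f)

theorem measurableSet_cylinder (n : ℕ) (f : G) : MeasurableSet (T.cylinder n f) := by
  refine measurableSet_space.2 fun n' f' => ?_
  -- a point lies in the cylinder if its position agrees, at some level, with one obtained from `f`
  have : T.point n' f' ⁻¹' T.cylinder n f =
      ⋃ m, ⋃ (_ : n ≤ m ∧ n' ≤ m), {ω | T.path n' f' ω m ∈ Set.range fun η => T.path n f η m} := by
    ext ω
    simp only [Set.mem_preimage, cylinder, Set.mem_range, Set.mem_iUnion, Set.mem_ofPred_eq,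
      exists_prop]
    constructor
    · rintro ⟨η, h⟩
      obtain ⟨m, h, h1, h2⟩ := ((germ_eq_germ.1 h).and
        ((eventually_ge_atTop n).and (eventually_ge_atTop n'))).exists
      exact ⟨m, ⟨h1, h2⟩, η, h⟩
    · rintro ⟨m, ⟨h1, h2⟩, η, h⟩
      refine ⟨fun i => if i < m then η i else ω i, ?_⟩
      rw [← point_path h1, ← point_path h2, ← h, path_congr (ω' := η)]
      · exact point_congr fun i hi => if_neg hi.not_gt
      · exact fun i _ hi => if_pos hi
  rw [this]
  exact .iUnion fun m => .iUnion fun _ => measurableSet_path _ _ _ _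

variable (T) in
/-- The points that have a position in the finite sets of the tower from some level on. -/
def regular : Set T.Space := {x | ∃ n, ∃ f ∈ T.F n, ∃ ω, T.point n f ω = x}

theorem smul_mem_regular {x : T.Space} (hx : x ∈ T.regular) (g : G) : g • x ∈ T.regular := by
  obtain ⟨n, f, hf, ω, rfl⟩ := hx
  obtain ⟨m, hm, hnm⟩ := ((T.absorb g).and (eventually_ge_atTop n)).exists
  refine ⟨m + 1, _, hm _ (path_mem (ω := ω) hf hnm) (ω m), ω, ?_⟩
  rw [← smul_point, point_succ, point_path hnm]

/-- The limit of functions on the levels of a tower, as a function on the space. -/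
noncomputable def limitFun (p : ℕ → G → ℝ) (x : T.Space) : ℝ :=
  Germ.liftOn (l := atTop) (β := Shrink.{0} G) x
    (fun s => limsup (fun m => p m ((equivShrink G).symm (s m))) atTop)
    fun _ _ h => limsup_congr (h.mono fun _ hm => by rw [hm])

theorem limitFun_germ (p : ℕ → G → ℝ) (s : ℕ → G) :
    limitFun p (T.germ s) = limsup (fun m => p m (s m)) atTop := by
  change limsup (fun m => p m ((equivShrink G).symm (equivShrink G (s m)))) atTop = _
  simp only [Equiv.symm_apply_apply]

theorem measurable_limitFun (p : ℕ → G → ℝ) : Measurable (limitFun p : T.Space → ℝ) := by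
  refine measurable_of_comp_point fun n f => ?_
  have : (limitFun p : T.Space → ℝ) ∘ T.point n f =
      fun ω => limsup (fun m => p m (T.path n f ω m)) atTop :=
    funext fun ω => limitFun_germ p _
  rw [this]
  exact Measurable.limsup fun m B _ => measurableSet_path n f m (p m ⁻¹' B)

/-- If the functions extend each other, their limit has the expected values. -/
theorem limitFun_point {p : ℕ → G → ℝ}
    (hp : ∀ n, ∀ f ∈ T.F n, ∀ i, p (n + 1) (f * T.c n i) = p n f) (hf : f ∈ T.F n) :
    limitFun p (T.point n f ω) = p n f := by
  rw [point, limitFun_germ]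
  have : (fun m => p m (T.path n f ω m)) =ᶠ[atTop] fun _ => p n f := by
    filter_upwards [eventually_ge_atTop n] with m hm
    induction m, hm using Nat.le_induction with
    | base => rw [path_of_le le_rfl]
    | succ m hm ih => rw [path_succ hm, hp m _ (path_mem hf hm), ih]
  rw [limsup_congr this, limsup_const]

end Tower

namespace Tower

/-! ### The measure -/

section Measure

open ProbabilityTheory
open scoped ENNReal

variable {G : Type*} [Group G] (T : Tower G)

/-- The law of a code whose coordinates are independent and uniformly distributed. -/
noncomputable def coin : Measure T.Code :=
  Measure.infinitePi fun i => (PMF.uniformOfFintype (Fin (T.N i + 1))).toMeasure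

instance : IsProbabilityMeasure T.coin := by unfold coin; infer_instance

theorem iIndep_coin :
    iIndep (fun i => MeasurableSpace.comap (fun ω : T.Code => ω i) inferInstance) T.coin :=
  iIndepFun_infinitePi (X := fun _ x => x) fun _ => measurable_id

theorem coin_eval (n : ℕ) (i : Fin (T.N n + 1)) :
    T.coin ((fun ω => ω n) ⁻¹' {i}) = (T.N n + 1 : ℝ≥0∞)⁻¹ := by
  rw [← Measure.map_apply (measurable_pi_apply n) (measurableSet_singleton i), coin,
    Measure.infinitePi_map_eval, PMF.toMeasure_apply_singleton _ _ (measurableSet_singleton i),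
    PMF.uniformOfFintype_apply, Fintype.card_fin]
  push_cast
  rfl

variable {T}

/-- A measurable set of codes that only depends on the coordinates from `n` on is measurable with
respect to these coordinates. -/
theorem measurableSet_tail {n : ℕ} {S : Set T.Code} (hS : MeasurableSet S)
    (h : ∀ ω ω' : T.Code, (∀ i, n ≤ i → ω i = ω' i) → (ω ∈ S ↔ ω' ∈ S)) :
    MeasurableSet[⨆ i ∈ Set.Ici n,
      MeasurableSpace.comap (fun ω : T.Code => ω i) inferInstance] S := by
  let ρ : T.Code → T.Code := fun ω i => if n ≤ i then ω i else 0
  have hρ : S = ρ ⁻¹' S := by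
    ext ω
    exact h ω (ρ ω) fun i hi => (if_pos hi).symm
  rw [hρ]
  have hmeas : Measurable[⨆ i ∈ Set.Ici n,
      MeasurableSpace.comap (fun ω : T.Code => ω i) inferInstance] ρ := by
    refine @measurable_pi_lambda _ _ _ (_) _ _ fun i => ?_
    by_cases hi : n ≤ i
    · simp only [ρ, if_pos hi]
      exact (comap_measurable _).mono (le_iSup₂_of_le i hi le_rfl) le_rfl
    · simp only [ρ, if_neg hi]
      exact @measurable_const _ _ _ (_) _
  exact hmeas hS

variable (T)

/-- The mass of a position at level `n`: the mass of a position at level `0` is `1`, and passing to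
the next level distributes the mass evenly among the copies. -/
noncomputable def scale (n : ℕ) : ℝ≥0∞ := ∏ i ∈ Finset.range n, (T.N i + 1 : ℝ≥0∞)⁻¹

theorem scale_succ (n : ℕ) : T.scale (n + 1) = T.scale n * (T.N n + 1 : ℝ≥0∞)⁻¹ :=
  Finset.prod_range_succ _ _

theorem scale_le (n : ℕ) : T.scale n ≤ 2⁻¹ ^ n := by
  induction n with
  | zero => simp [scale]
  | succ n ih =>
    rw [scale_succ, pow_succ]
    gcongr
    have : (1 : ℝ≥0∞) ≤ T.N n := by exact_mod_cast T.one_le_N n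
    calc (2 : ℝ≥0∞) = 1 + 1 := by norm_num
      _ ≤ T.N n + 1 := by gcongr

theorem scale_le_one (n : ℕ) : T.scale n ≤ 1 :=
  (T.scale_le n).trans (pow_le_one₀ zero_le (by simp))

theorem scale_succ_mul (n : ℕ) : T.scale (n + 1) * (T.N n + 1) = T.scale n := by
  rw [scale_succ, mul_assoc, ENNReal.inv_mul_cancel, mul_one]
  · simp
  · exact ENNReal.add_ne_top.2 ⟨ENNReal.natCast_ne_top _, ENNReal.one_ne_top⟩

variable [Small.{0} G]

/-- The measure that gives mass `T.scale n` to the cylinder of position `f` at level `n`. -/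
noncomputable def cylMeasure (n : ℕ) (f : G) : Measure T.Space :=
  T.scale n • T.coin.map (T.point n f)

variable {T} {n m : ℕ} {f f' : G}

theorem cylMeasure_apply {S : Set T.Space} (hS : MeasurableSet S) :
    T.cylMeasure n f S = T.scale n * T.coin (T.point n f ⁻¹' S) := by
  rw [cylMeasure, Measure.smul_apply, Measure.map_apply (measurable_point n f) hS, smul_eq_mul]

theorem cylMeasure_le (S : Set T.Space) : T.cylMeasure n f S ≤ T.scale n := by
  refine (measure_mono (Set.subset_univ S)).trans ?_
  rw [cylMeasure_apply .univ]
  exact mul_le_of_le_one_right' prob_le_one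

/-- The position at level `n + 1` of a point with position `f` at level `n` is uniformly
distributed over the copies of `f`. -/
theorem cylMeasure_eq_sum (n : ℕ) (f : G) :
    T.cylMeasure n f = ∑ i, T.cylMeasure (n + 1) (f * T.c n i) := by
  ext S hS
  rw [Measure.finsetSum_apply, cylMeasure_apply hS]
  simp only [cylMeasure_apply hS, scale_succ, mul_assoc]
  rw [← Finset.mul_sum]
  congr 1
  have hsplit : T.point n f ⁻¹' S =
      ⋃ i, (fun ω => ω n) ⁻¹' {i} ∩ T.point (n + 1) (f * T.c n i) ⁻¹' S := by
    ext ω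
    simp [← point_succ (T := T) (n := n) (f := f) (ω := ω)]
  rw [hsplit, measure_iUnion, tsum_fintype]
  · refine Finset.sum_congr rfl fun i _ => ?_
    have hind := indep_iSup_of_disjoint (fun i => (measurable_pi_apply i).comap_le)
      T.iIndep_coin (S := {n}) (T := Set.Ici (n + 1)) (by simp)
    have h1 : MeasurableSet[⨆ i ∈ ({n} : Set ℕ),
        MeasurableSpace.comap (fun ω : T.Code => ω i) inferInstance]
        ((fun ω : T.Code => ω n) ⁻¹' {i}) := by
      rw [iSup_singleton]
      exact ⟨{i}, measurableSet_singleton i, rfl⟩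
    have h2 := measurableSet_tail (n := n + 1)
      (measurable_point (T := T) (n + 1) (f * T.c n i) hS) fun ω ω' h => by
        rw [Set.mem_preimage, Set.mem_preimage, point_congr h]
    rw [(Indep_iff _ _ _).1 hind _ _ h1 h2, coin_eval]
  · intro i j hij
    refine Set.disjoint_left.2 fun ω hi hj => hij ?_
    exact hi.1.symm.trans hj.1
  · exact fun i => (measurable_pi_apply n (measurableSet_singleton i)).inter
      (measurable_point _ _ hS)

theorem cylMeasure_compl_cylinder (n : ℕ) (f : G) :
    T.cylMeasure n f (T.cylinder n f)ᶜ = 0 := by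
  rw [cylMeasure_apply (measurableSet_cylinder n f).compl]
  have : T.point n f ⁻¹' (T.cylinder n f)ᶜ = ∅ := by
    ext ω
    simp [cylinder]
  rw [this, measure_empty, mul_zero]

theorem map_smul_cylMeasure (g : G) (n : ℕ) (f : G) :
    (T.cylMeasure n f).map (fun x => g • x) = T.cylMeasure n (g * f) := by
  rw [cylMeasure, Measure.map_smul, Measure.map_map (measurable_const_smul g)
    (measurable_point n f), cylMeasure]
  congr 2
  funext ω
  exact smul_point g

theorem preimage_point_eq_empty_of_ne (hf : f ∈ T.F n) (hf' : f' ∈ T.F n) (h : f ≠ f') :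
    T.point n f ⁻¹' T.cylinder n f' = ∅ := by
  refine Set.eq_empty_of_forall_notMem fun ω => ?_
  rintro ⟨η, hη⟩
  have := path_eq_of_point_eq hf' hf le_rfl le_rfl hη
  rw [path_of_le le_rfl, path_of_le le_rfl] at this
  exact h this.symm

variable [DecidableEq G]

theorem preimage_point_spacer_eq_empty (hf : f ∈ T.spacer (m + 1)) (hf' : f' ∈ T.F n)
    (hnm : n ≤ m) : T.point (m + 1) f ⁻¹' T.cylinder n f' = ∅ := by
  refine Set.eq_empty_of_forall_notMem fun ω => ?_
  rintro ⟨η, hη⟩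
  have := path_eq_of_point_eq hf' (Finset.mem_sdiff.1 hf).1 (hnm.trans m.le_succ) le_rfl hη
  rw [path_of_le (n := m + 1) le_rfl, path_succ hnm] at this
  exact (Finset.mem_sdiff.1 hf).2 (this ▸
    Finset.mem_image₂_of_mem (f := fun f i => f * T.c m i) (path_mem hf' hnm) (Finset.mem_univ _))

variable (T)

/-- The measure carried by the positions that are new at level `n`. -/
noncomputable def layer (n : ℕ) : Measure T.Space := ∑ f ∈ T.spacer n, T.cylMeasure n f

/-- The invariant measure of a tower. -/
noncomputable def measure : Measure T.Space := Measure.sum T.layer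

theorem sum_layer (n : ℕ) :
    ∑ i ∈ Finset.range (n + 1), T.layer i = ∑ f ∈ T.F n, T.cylMeasure n f := by
  induction n with
  | zero => simp [layer, spacer]
  | succ n ih =>
    set I := Finset.image₂ (fun f i => f * T.c n i) (T.F n) Finset.univ with hI
    have hsub : I ⊆ T.F (n + 1) := by
      intro x hx
      obtain ⟨f, hf, i, -, rfl⟩ := Finset.mem_image₂.1 hx
      exact T.mul_mem hf i
    have himg : ∑ x ∈ I, T.cylMeasure (n + 1) x = ∑ f ∈ T.F n, T.cylMeasure n f := by
      have hinj : Set.InjOn (fun x : G × Fin (T.N n + 1) => x.1 * T.c n x.2)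
          (T.F n ×ˢ (Finset.univ : Finset (Fin (T.N n + 1))) : Finset _) := by
        rintro ⟨f, i⟩ hx ⟨f', j⟩ hy hxy
        obtain ⟨rfl, rfl⟩ := T.inj (Finset.mem_product.1 hx).1 (Finset.mem_product.1 hy).1 hxy
        rfl
      simp only [cylMeasure_eq_sum (T := T) n]
      rw [← Finset.sum_product', hI, ← Finset.image_uncurry_product]
      exact Finset.sum_image hinj
    rw [Finset.sum_range_succ, ih, ← himg, layer, spacer, ← hI, add_comm,
      Finset.sum_sdiff hsub]

variable {T}

theorem sum_cylMeasure_le (n : ℕ) (S : Set T.Space) :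
    ∑ f ∈ T.F n, T.cylMeasure n f S ≤ T.measure S := by
  rw [← Measure.finsetSum_apply, ← sum_layer, Measure.finsetSum_apply]
  exact (ENNReal.sum_le_tsum _).trans (Measure.le_sum_apply _ _)

theorem measure_le_iff {S : Set T.Space} (hS : MeasurableSet S) {b : ℝ≥0∞} :
    T.measure S ≤ b ↔ ∀ n, ∑ f ∈ T.F n, T.cylMeasure n f S ≤ b := by
  refine ⟨fun h n => (sum_cylMeasure_le n S).trans h, fun h => ?_⟩
  rw [measure, Measure.sum_apply _ hS, ENNReal.tsum_eq_iSup_nat]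
  refine iSup_le fun n => le_trans ?_ (h n)
  rw [← Measure.finsetSum_apply (T.F n), ← sum_layer, Measure.finsetSum_apply]
  exact Finset.sum_le_sum_of_subset (Finset.range_mono n.le_succ)

theorem measure_eq_zero_iff {S : Set T.Space} (hS : MeasurableSet S) :
    T.measure S = 0 ↔ ∀ n, ∀ f ∈ T.F n, T.cylMeasure n f S = 0 := by
  rw [← nonpos_iff_eq_zero, measure_le_iff hS]
  simp only [nonpos_iff_eq_zero, Finset.sum_eq_zero_iff]

theorem sum_cylMeasure_mono (S : Set T.Space) :
    Monotone fun n => ∑ f ∈ T.F n, T.cylMeasure n f S := by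
  intro n m h
  simp only [← Measure.finsetSum_apply, ← sum_layer]
  rw [Measure.finsetSum_apply, Measure.finsetSum_apply]
  exact Finset.sum_le_sum_of_subset (Finset.range_mono (by omega))

theorem measure_cylinder_le (hf : f ∈ T.F n) : T.measure (T.cylinder n f) ≤ T.scale n := by
  have hmeas := measurableSet_cylinder (T := T) n f
  have hn : ∑ f' ∈ T.F n, T.cylMeasure n f' (T.cylinder n f) ≤ T.scale n := by
    rw [Finset.sum_eq_single_of_mem f hf]
    · exact cylMeasure_le _
    · intro f' hf' hne
      rw [cylMeasure_apply hmeas, preimage_point_eq_empty_of_ne hf' hf hne, measure_empty, mul_zero]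
  refine (measure_le_iff hmeas).2 fun m => ?_
  rcases le_total m n with h | h
  · exact (sum_cylMeasure_mono _ h).trans hn
  refine le_trans (le_of_eq ?_) hn
  -- levels after `n` add nothing to the measure of the cylinder
  induction m, h using Nat.le_induction with
  | base => rfl
  | succ m h ih =>
    have hz : T.layer (m + 1) (T.cylinder n f) = 0 := by
      rw [layer, Measure.finsetSum_apply]
      refine Finset.sum_eq_zero fun f' hf' => ?_
      rw [cylMeasure_apply hmeas, preimage_point_spacer_eq_empty hf' hf h, measure_empty, mul_zero]
    rw [← ih]
    simp only [← Measure.finsetSum_apply, ← sum_layer]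
    rw [Finset.sum_range_succ _ (m + 1), Measure.add_apply, hz, add_zero]

theorem ae_mem_regular : ∀ᵐ x ∂T.measure, x ∈ T.regular := by
  have hmeas : MeasurableSet T.regular := by
    have : T.regular = ⋃ n, ⋃ f ∈ T.F n, T.cylinder n f := by
      ext x
      simp [regular, cylinder]
    rw [this]
    exact .iUnion fun n => Finset.measurableSet_biUnion _ fun f _ => measurableSet_cylinder n f
  rw [ae_iff, ← Set.compl_def, measure_eq_zero_iff hmeas.compl]
  intro n f hf
  refine measure_mono_null (Set.compl_subset_compl.2 ?_) (cylMeasure_compl_cylinder n f)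
  rintro _ ⟨ω, rfl⟩
  exact ⟨n, f, hf, ω, rfl⟩

theorem measure_ne_zero : T.measure ≠ 0 := by
  obtain ⟨f, hf⟩ := T.nonempty
  intro h
  have := (measure_eq_zero_iff (T := T) .univ).1 (by rw [h]; rfl) 0 f hf
  rw [cylMeasure_apply .univ] at this
  simp [scale] at this

end Measure

end Tower

namespace Tower

/-! ### Ergodicity, integrability and non-atomicity -/

section Ergodic

open ProbabilityTheory
open scoped ENNReal

variable {G : Type*} [Group G] [DecidableEq G] [Small.{0} G] {T : Tower G}

instance [Countable G] : SigmaFinite T.measure := by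
  refine Measure.sigmaFinite_of_countable
    (S := insert T.regularᶜ {S | ∃ n, ∃ f ∈ T.F n, S = T.cylinder n f}) ?_ ?_ ?_
  · refine Set.Countable.insert _ ((Set.countable_range fun x : ℕ × G => T.cylinder x.1 x.2).mono ?_)
    rintro _ ⟨n, f, -, rfl⟩
    exact ⟨(n, f), rfl⟩
  · rintro _ (rfl | ⟨n, f, hf, rfl⟩)
    · rw [show T.measure T.regularᶜ = 0 from ae_iff.1 ae_mem_regular]
      exact ENNReal.zero_lt_top
    · exact ((measure_cylinder_le hf).trans (T.scale_le_one n)).trans_lt ENNReal.one_lt_top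
  · refine Set.eq_univ_of_forall fun x => ?_
    by_cases hx : x ∈ T.regular
    · obtain ⟨n, f, hf, ω, rfl⟩ := hx
      exact ⟨_, Or.inr ⟨n, f, hf, rfl⟩, ω, rfl⟩
    · exact ⟨_, Or.inl rfl, hx⟩

theorem map_smul_measure_le (g : G) : T.measure.map (fun x => g • x) ≤ T.measure := by
  refine Measure.le_iff.2 fun S hS => ?_
  have hg := measurable_const_smul (α := T.Space) g
  rw [Measure.map_apply hg hS, measure_le_iff (hg hS)]
  intro n
  obtain ⟨m, hm, hnm⟩ := ((T.absorb g).and (eventually_ge_atTop n)).exists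
  -- the translates by `g` of the copies of `F m` stay within `F (m + 1)`
  calc ∑ f ∈ T.F n, T.cylMeasure n f ((fun x => g • x) ⁻¹' S)
      ≤ ∑ f ∈ T.F m, T.cylMeasure m f ((fun x => g • x) ⁻¹' S) := sum_cylMeasure_mono _ hnm
    _ = ∑ f ∈ T.F m, ∑ i, T.cylMeasure (m + 1) (g * (f * T.c m i)) S := by
        refine Finset.sum_congr rfl fun f _ => ?_
        rw [← Measure.map_apply hg hS, map_smul_cylMeasure, cylMeasure_eq_sum,
          Measure.finsetSum_apply]
        simp only [mul_assoc]
    _ = ∑ h ∈ (T.F m ×ˢ Finset.univ).image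
          (fun x : G × Fin (T.N m + 1) => g * (x.1 * T.c m x.2)),
          T.cylMeasure (m + 1) h S := by
        rw [← Finset.sum_product', Finset.sum_image]
        rintro ⟨f, i⟩ hx ⟨f', j⟩ hy hxy
        obtain ⟨rfl, rfl⟩ := T.inj (Finset.mem_product.1 hx).1 (Finset.mem_product.1 hy).1
          (mul_left_cancel hxy)
        rfl
    _ ≤ ∑ h ∈ T.F (m + 1), T.cylMeasure (m + 1) h S := by
        refine Finset.sum_le_sum_of_subset fun h hh => ?_
        obtain ⟨⟨f, i⟩, hx, rfl⟩ := Finset.mem_image.1 hh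
        exact hm f (Finset.mem_product.1 hx).1 i
    _ ≤ T.measure S := sum_cylMeasure_le _ _

instance : SMulInvariantMeasure G T.Space T.measure where
  measure_preimage_smul g S hS := by
    have hle : ∀ (g : G) {S : Set T.Space}, MeasurableSet S →
        T.measure ((fun x => g • x) ⁻¹' S) ≤ T.measure S := fun g S hS => by
      rw [← Measure.map_apply (measurable_const_smul g) hS]
      exact map_smul_measure_le g S
    refine le_antisymm (hle g hS) ?_
    have := hle g⁻¹ (measurable_const_smul g hS)
    simpa only [Set.preimage_preimage, smul_inv_smul, Set.preimage_id'] using this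

/-- The set of codes of the points of an invariant set is a tail event, so by Kolmogorov's zero-one
law an invariant set is null or conull. -/
theorem measure_eq_zero_or_of_invariant {S : Set T.Space} (hS : MeasurableSet S)
    (hinv : ∀ g : G, (fun x => g • x) ⁻¹' S = S) : T.measure S = 0 ∨ T.measure Sᶜ = 0 := by
  set E : Set T.Code := T.point 0 1 ⁻¹' S
  have hpt : ∀ n f, T.point n f ⁻¹' S = E := by
    have h1 : ∀ n f, T.point n f ⁻¹' S = T.point n 1 ⁻¹' S := fun n f => by
      ext ω
      rw [Set.mem_preimage, ← mul_one f, ← smul_point]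
      exact Set.ext_iff.1 (hinv f) _
    have h2 : ∀ n, T.point n 1 ⁻¹' S = E := fun n => by
      induction n with
      | zero => rfl
      | succ n ih =>
        rw [← ih]
        ext ω
        rw [Set.mem_preimage, Set.mem_preimage, ← point_succ (n := n) (f := 1)]
        exact Set.ext_iff.1 (h1 (n + 1) _).symm ω
    exact fun n f => (h1 n f).trans (h2 n)
  have hEm : MeasurableSet E := measurable_point 0 1 hS
  have htail : MeasurableSet[limsup
      (fun i => MeasurableSpace.comap (fun ω : T.Code => ω i) inferInstance) atTop] E := by
    rw [limsup_eq_iInf_iSup_of_nat, MeasurableSpace.measurableSet_iInf]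
    intro n
    refine measurableSet_tail (n := n) hEm fun ω ω' h => ?_
    rw [← hpt n 1, Set.mem_preimage, Set.mem_preimage, point_congr h]
  rcases measure_zero_or_one_of_measurableSet_limsup_atTop
    (fun i => (measurable_pi_apply i).comap_le) T.iIndep_coin htail with h | h
  · left
    refine (measure_eq_zero_iff hS).2 fun n f _ => ?_
    rw [cylMeasure_apply hS, hpt, h, mul_zero]
  · right
    refine (measure_eq_zero_iff hS.compl).2 fun n f _ => ?_
    rw [cylMeasure_apply hS.compl, Set.preimage_compl, hpt, (prob_compl_eq_zero_iff hEm).2 h,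
      mul_zero]

theorem ergodicSMul_measure [Countable G] : ErgodicSMul G T.Space T.measure where
  aeconst_of_forall_preimage_smul_ae_eq {S} hS hinv := by
    -- an almost invariant set is replaced by the strictly invariant intersection of its translates
    set S' : Set T.Space := ⋂ g : G, (fun x => g • x) ⁻¹' S with hS'
    have hmeas : MeasurableSet S' := .iInter fun g => measurable_const_smul g hS
    have heq : S' =ᵐ[T.measure] S :=
      (Filter.EventuallyEq.countable_iInter hinv).trans (.of_eq (Set.iInter_const S))
    have hinv' : ∀ g : G, (fun x => g • x) ⁻¹' S' = S' := fun g => by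
      ext x
      simp only [hS', Set.mem_preimage, Set.mem_iInter, smul_smul]
      exact ⟨fun h a => by simpa using h (a * g⁻¹), fun h a => h (a * g)⟩
    refine EventuallyConst.congr ?_ heq
    rw [eventuallyConst_set']
    rcases measure_eq_zero_or_of_invariant hmeas hinv' with h | h
    · exact Or.inl (ae_eq_empty.2 h)
    · exact Or.inr (ae_eq_univ.2 h)

theorem isNonatomic_measure : IsNonatomic T.measure := by
  intro S hS hpos
  obtain ⟨n, f, hf, hne⟩ : ∃ n, ∃ f ∈ T.F n, T.cylMeasure n f S ≠ 0 := by
    by_contra! h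
    exact hpos.ne' ((measure_eq_zero_iff hS).2 h)
  obtain ⟨m, hm, hnm⟩ : ∃ m, T.scale m < T.measure S ∧ n ≤ m := by
    have ht : Tendsto (fun m => (2⁻¹ : ℝ≥0∞) ^ m) atTop (𝓝 0) :=
      ENNReal.tendsto_pow_atTop_nhds_zero_of_lt_one (by simp)
    obtain ⟨m, hm, hnm⟩ := ((ht.eventually_lt_const hpos).and (eventually_ge_atTop n)).exists
    exact ⟨m, (T.scale_le m).trans_lt hm, hnm⟩
  obtain ⟨h, hh, hhS⟩ : ∃ h ∈ T.F m, T.cylMeasure m h S ≠ 0 := by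
    by_contra! h0
    have h1 := sum_cylMeasure_mono (T := T) S hnm
    simp only [Finset.sum_eq_zero h0, nonpos_iff_eq_zero, Finset.sum_eq_zero_iff] at h1
    exact hne (h1 f hf)
  have hcyl := measurableSet_cylinder (T := T) m h
  refine ⟨S ∩ T.cylinder m h, Set.inter_subset_left, hS.inter hcyl, ?_, ?_⟩
  · have h1 : T.cylMeasure m h (S ∩ T.cylinder m h) = T.cylMeasure m h S :=
      measure_inter_conull (cylMeasure_compl_cylinder m h)
    refine lt_of_lt_of_le ?_ (sum_cylMeasure_le m _)
    refine lt_of_lt_of_le (pos_iff_ne_zero.2 (h1 ▸ hhS))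
      (Finset.single_le_sum (f := fun f => T.cylMeasure m f (S ∩ T.cylinder m h))
        (fun _ _ => zero_le) hh)
  · exact ((measure_mono Set.inter_subset_right).trans (measure_cylinder_le hh)).trans_lt hm

namespace IsDensity

variable {p : ℕ → G → ℝ}

theorem limitFun_pos (hp : T.IsDensity p) {x : T.Space} (hx : x ∈ T.regular) :
    0 < limitFun p x := by
  obtain ⟨n, f, hf, ω, rfl⟩ := hx
  rw [limitFun_point hp.step hf]
  exact hp.pos n f

theorem limitFun_le_one (hp : T.IsDensity p) {x : T.Space} (hx : x ∈ T.regular) :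
    limitFun p x ≤ 1 := by
  obtain ⟨n, f, hf, ω, rfl⟩ := hx
  rw [limitFun_point hp.step hf]
  exact hp.le_one n f

theorem memLp_top (hp : T.IsDensity p) : MemLp (limitFun p : T.Space → ℝ) ⊤ T.measure := by
  refine memLp_top_of_bound (measurable_limitFun p).aestronglyMeasurable 1 ?_
  filter_upwards [ae_mem_regular] with x hx
  rw [Real.norm_of_nonneg (hp.limitFun_pos hx).le]
  exact hp.limitFun_le_one hx

theorem lintegral_layer (hp : T.IsDensity p) (n : ℕ) :
    ∫⁻ x, ‖(limitFun p x : ℝ)‖ₑ ∂T.layer n =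
      T.scale n * ENNReal.ofReal (∑ f ∈ T.spacer n, p n f) := by
  have hsub : T.spacer n ⊆ T.F n := by
    cases n with
    | zero => exact Finset.Subset.refl _
    | succ n => exact Finset.sdiff_subset
  have hmeas := (measurable_limitFun (T := T) p).enorm
  rw [layer, lintegral_finsetSum_measure, ENNReal.ofReal_sum_of_nonneg fun f _ => (hp.pos n f).le,
    Finset.mul_sum]
  refine Finset.sum_congr rfl fun f hf => ?_
  rw [cylMeasure, lintegral_smul_measure, lintegral_map hmeas (measurable_point n f), smul_eq_mul]
  simp only [limitFun_point hp.step (hsub hf)]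
  rw [lintegral_const, measure_univ, mul_one, Real.enorm_of_nonneg (hp.pos n f).le]

theorem memLp_one (hp : T.IsDensity p) : MemLp (limitFun p : T.Space → ℝ) 1 T.measure := by
  refine memLp_one_iff_integrable.2 ⟨(measurable_limitFun p).aestronglyMeasurable, ?_⟩
  have hsucc : ∀ n, ∫⁻ x, ‖(limitFun p x : ℝ)‖ₑ ∂T.layer (n + 1) ≤ 2⁻¹ ^ n := fun n => by
    have h2 : ENNReal.ofReal ((T.N n + 1) * (1 / 2) ^ n) = (T.N n + 1) * 2⁻¹ ^ n := by
      rw [ENNReal.ofReal_mul (by positivity), ENNReal.ofReal_pow (by norm_num),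
        ENNReal.ofReal_add (by positivity) zero_le_one, ENNReal.ofReal_natCast, one_div,
        ENNReal.ofReal_inv_of_pos two_pos]
      simp
    calc ∫⁻ x, ‖(limitFun p x : ℝ)‖ₑ ∂T.layer (n + 1)
        ≤ T.scale (n + 1) * ((T.N n + 1) * 2⁻¹ ^ n) := by
          rw [hp.lintegral_layer, ← h2]
          gcongr
          exact hp.sum_le n
      _ = T.scale n * 2⁻¹ ^ n := by rw [← mul_assoc, scale_succ_mul]
      _ ≤ 2⁻¹ ^ n := mul_le_of_le_one_left' (T.scale_le_one n)
  rw [HasFiniteIntegral, measure, lintegral_sum_measure, tsum_eq_zero_add' ENNReal.summable]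
  refine ENNReal.add_lt_top.2 ⟨?_, (ENNReal.tsum_le_tsum hsucc).trans_lt ?_⟩
  · rw [hp.lintegral_layer]
    exact ENNReal.mul_lt_top ((T.scale_le_one 0).trans_lt ENNReal.one_lt_top)
      ENNReal.ofReal_lt_top
  · rw [ENNReal.tsum_geometric]
    simp

theorem integral_ne_zero (hp : T.IsDensity p) :
    ∫ x, (limitFun p x : ℝ) ∂T.measure ≠ 0 := by
  have hpos : ∀ᵐ x ∂T.measure, 0 < limitFun p x :=
    ae_mem_regular.mono fun x hx => hp.limitFun_pos hx
  have hint := memLp_one_iff_integrable.1 hp.memLp_one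
  intro h
  rw [integral_eq_zero_iff_of_nonneg_ae (hpos.mono fun x hx => hx.le) hint] at h
  have : NeBot (ae T.measure) := ae_neBot.2 measure_ne_zero
  obtain ⟨x, hx, hx'⟩ := (hpos.and h).exists
  exact hx.ne' hx'

end IsDensity

/-- The sums over a finite set at a point are computed at the next level, provided that the
translates do not leave the tower there. -/
theorem ergodicSum_limitFun {p : ℕ → G → ℝ} (hp : T.IsDensity p) {n : ℕ} {f : G} {ω : T.Code}
    {B : Finset G} (hB : ∀ g ∈ B, g * (f * T.c n (ω n)) ∈ T.F (n + 1)) :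
    ergodicSum B (limitFun p) (T.point n f ω) =
      ∑ g ∈ B, p (n + 1) (g * (f * T.c n (ω n))) := by
  refine Finset.sum_congr rfl fun g hg => ?_
  rw [← point_succ, smul_point, limitFun_point hp.step (hB g hg)]

end Ergodic

end Tower

/-! ### Divergence of the ratios -/

theorem theorem2p7 {G : Type*} [Group G] [DecidableEq G]
    (A : Finset G) (hsymm : A⁻¹ = A) (hgen : Subgroup.closure (A : Set G) = ⊤)
    (k : ℕ → ℕ) (hF : IsStronglyNonBesicovitch fun n => wordBall A (k n)) :
    ∃ (X : Type) (_ : MeasurableSpace X) (_ : MulAction G X) (_ : MeasurableConstSMul G X)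
      (μ : Measure X) (φ ψ : X → ℝ),
      SigmaFinite μ ∧ IsNonatomic μ ∧ ErgodicSMul G X μ ∧
      MemLp φ 1 μ ∧ MemLp φ ⊤ μ ∧ MemLp ψ 1 μ ∧ MemLp ψ ⊤ μ ∧
      ∫ x, ψ x ∂μ ≠ 0 ∧
      ∀ᵐ x ∂μ,
        (∀ᶠ n in atTop, ergodicSum (wordBall A (k n)) ψ x ≠ 0) ∧
        ¬ ∃ L : ℝ, Tendsto (fun n => ergodicRatio (wordBall A (k n)) φ ψ x) atTop (𝓝 L) := by
  have : Countable G := countable_of_closure_eq_top hsymm hgen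
  obtain ⟨T, p, q, hp, hq, hosc⟩ := hF.exists_tower hsymm hgen
  refine ⟨T.Space, inferInstance, inferInstance, inferInstance, T.measure, Tower.limitFun p,
    Tower.limitFun q, inferInstance, Tower.isNonatomic_measure, Tower.ergodicSMul_measure,
    hp.memLp_one, hp.memLp_top, hq.memLp_one, hq.memLp_top, hq.integral_ne_zero, ?_⟩
  filter_upwards [Tower.ae_mem_regular] with x hx
  have hpos : ∀ m, 0 < ergodicSum (wordBall A (k m)) (Tower.limitFun q) x := fun m =>
    Finset.sum_pos (fun g _ => hq.limitFun_pos (Tower.smul_mem_regular hx g))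
      ⟨1, one_mem_wordBall _⟩
  refine ⟨Eventually.of_forall fun m => (hpos m).ne', ?_⟩
  rintro ⟨L, hL⟩
  obtain ⟨n₀, f, hf, ω, rfl⟩ := hx
  set x := T.point n₀ f ω
  have hlevel : ∀ n, n₀ ≤ n → ∃ m, n < k m ∧
      (Even n → 2 ≤ ergodicRatio (wordBall A (k m)) (Tower.limitFun p) (Tower.limitFun q) x) ∧
      (¬ Even n → ergodicRatio (wordBall A (k m)) (Tower.limitFun p) (Tower.limitFun q) x ≤
        1 / 2) := by
    intro n hn
    obtain ⟨m, hm, hB, he, ho⟩ := hosc n _ (Tower.path_mem (ω := ω) hf hn) (ω n)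
    rw [← Tower.ergodicSum_limitFun hp hB, ← Tower.ergodicSum_limitFun hq hB,
      Tower.point_path hn] at he ho
    refine ⟨m, hm, fun h => ?_, fun h => ?_⟩
    · rw [ergodicRatio, le_div_iff₀ (hpos m)]
      exact he h
    · rw [ergodicRatio, div_le_iff₀ (hpos m)]
      have := ho h
      linarith
  -- radii beyond all of `k 0, ..., k M` are only attained at indices beyond `M`
  have hfar : ∀ M, ∃ n₁, n₀ ≤ n₁ ∧ ∀ n m, n₁ ≤ n → n < k m → M ≤ m := fun M => by
    refine ⟨max n₀ ((Finset.range M).sup k), le_max_left _ _, fun n m hn hm => ?_⟩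
    by_contra! h
    have := Finset.le_sup (f := k) (Finset.mem_range.2 h)
    have := (le_max_right n₀ ((Finset.range M).sup k)).trans hn
    omega
  have hge : 2 ≤ L := by
    refine ge_of_tendsto_of_frequently hL (frequently_atTop.2 fun M => ?_)
    obtain ⟨n₁, h₁, h₂⟩ := hfar M
    obtain ⟨m, hm, he, -⟩ := hlevel (2 * n₁) (by omega)
    exact ⟨m, h₂ _ m (by omega) hm, he (even_two_mul n₁)⟩
  have hle : L ≤ 1 / 2 := by
    refine le_of_tendsto_of_frequently hL (frequently_atTop.2 fun M => ?_)
    obtain ⟨n₁, h₁, h₂⟩ := hfar M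
    obtain ⟨m, hm, -, ho⟩ := hlevel (2 * n₁ + 1) (by omega)
    exact ⟨m, h₂ _ m (by omega) hm, ho (by simp [parity_simps])⟩
  linarith
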